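/- For a positive integer $n$ divisible by $8$, let EQ-$\binom{n}{n/4}$ be the following promise problem: two parties, Alice and Bob, receive strings $x,y\in\{0,1\}^n$ that are promised to be either equal or to differ in exactly $n/4$ positions, and they have to decide, without error, which is the case. In an $r$-round quantum protocol the parties start with private qubit registers (of any size) in the state $|0\cdots0\rangle$, with no shared entanglement, and alternate in sending messages: in each of the $r$ rounds the party whose turn it is appends some number of fresh qubits in the state $|0\cdots 0\rangle$ to its register, applies to the whole register a unitary depending only on its own input, and sends the appended qubits to the other party. Alice sends the last message (in particular, in a one-round protocol all communication is from Alice to Bob), after which Bob produces the answer by a measurement of his register that depends only on his own input. The numbers of qubits sent in the rounds, possibly zero, are fixed in advance. The $r$-round exact quantum communication complexity is the least total number of qubits sent in an $r$-round protocol that answers correctly with probability $1$ on all promised inputs. Then there are absolute constants $c,C\in(0,\infty)$ such that for every positive integer $n$ divisible by $8$: 1. the one-round exact quantum communication complexity of EQ-$\binom{n}{n/4}$ is at least $cn$; 2. the two-round exact quantum communication complexity of EQ-$\binom{n}{n/4}$ is at most $2\lceil\log_2 n\rceil+1$, and $2\lceil\log_2 n\rceil+1\le C\log_2 n$. -/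

import Mathlib

open scoped ComplexOrder ENNReal

/-- Bit strings of length `n`. They index the computational basis of an `n`-qubit register. -/
abbrev Bits (n : ℕ) : Type := Fin n → Bool

/-- A (pure) joint state of a `k`-qubit register and an `m`-qubit register, given by its amplitudes
in the computational basis. -/
abbrev JointState (k m : ℕ) : Type := Bits k → Bits m → ℂ

/-- The state `|0…0⟩|0…0⟩`. -/
def JointState.zero (k m : ℕ) : JointState k m := fun s t =>
  if s = (fun _ => false) ∧ t = (fun _ => false) then 1 else 0

/-- A quantum measurement (POVM) of a `k`-qubit register with two outcomes. -/
structure BinaryMeasurement (k : ℕ) where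
  effect : Bool → Matrix (Bits k) (Bits k) ℂ
  posSemidef : ∀ o, (effect o).PosSemidef
  sum_eq_one : effect true + effect false = 1

/-- The probability of outcome `o` when the first of the two registers is measured. -/
noncomputable def BinaryMeasurement.prob {k m : ℕ} (M : BinaryMeasurement k)
    (ψ : JointState k m) (o : Bool) : ℝ :=
  (∑ t, star (fun s => ψ s t) ⬝ᵥ (M.effect o).mulVec (fun s => ψ s t)).re

/-- One round of communication. The party holding the first (`k`-qubit) register appends `l` fresh
qubits in the state `|0…0⟩`, applies `U` to all `k + l` qubits of theirs, and sends the `l` qubits to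
the other party, who appends them to their own `m`-qubit register. In the resulting state the
receiver's register comes first. -/
def sendQubits {k m l : ℕ} (U : Matrix (Bits k × Bits l) (Bits k × Bits l) ℂ)
    (ψ : JointState k m) : JointState (m + l) k := fun w s =>
  ∑ s', U (s, fun i => w (Fin.natAdd m i)) (s', fun _ => false) * ψ s' (fun i => w (Fin.castAdd l i))

/-- Two-party quantum protocols with a two-valued output, both parties having an input from `X`.
`QProtocol X r k m` is the type of protocols with `r` rounds left to go, in which the party whose
turn it is holds a private register of `k` qubits and the other party one of `m` qubits.
After the last round, the receiver of the last message measures their register to get the output.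
The operations of a party depend only on that party's input. -/
inductive QProtocol (X : Type*) : ℕ → ℕ → ℕ → Type _ where
  | output {k m : ℕ} (M : X → BinaryMeasurement k) : QProtocol X 0 k m
  | send {r k m : ℕ} (l : ℕ) (U : X → Matrix.unitaryGroup (Bits k × Bits l) ℂ)
      (next : QProtocol X r (m + l) k) : QProtocol X (r + 1) k m

namespace QProtocol

variable {X : Type*}

/-- The total number of qubits communicated. -/
def cost : {r k m : ℕ} → QProtocol X r k m → ℕ
  | _, _, _, output _ => 0
  | _, _, _, send l _ next => l + next.cost

/-- The probability of output `o` when the protocol is run from the joint state `ψ`; `x` is the input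
of the party whose turn it is and `y` the input of the other party. -/
noncomputable def probFrom : {r k m : ℕ} → QProtocol X r k m → X → X → JointState k m → Bool → ℝ
  | _, _, _, output M, x, _, ψ, o => (M x).prob ψ o
  | _, _, _, send _ U next, x, y, ψ, o =>
      next.probFrom y x (sendQubits (U x : Matrix _ _ ℂ) ψ) o

/-- The probability of output `o`, both private registers being initially in the state `|0…0⟩`. -/
noncomputable def prob {r k m : ℕ} (P : QProtocol X r k m) (x y : X) (o : Bool) : ℝ :=
  P.probFrom x y (JointState.zero k m) o

/-- The protocol solves, without error, the promise equality problem given by the graph `G`: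
the inputs are promised to be equal or adjacent, and one has to tell which is the case
(`true` stands for `equal`). -/
def Solves {r k m : ℕ} (P : QProtocol X r k m) (G : SimpleGraph X) : Prop :=
  (∀ x, P.prob x x true = 1) ∧ ∀ x y, G.Adj x y → P.prob x y false = 1

end QProtocol

/-- The `r`-round exact quantum communication complexity of the promise equality problem of `G`: the
least number of qubits communicated by an `r`-round protocol for it (`⊤` if there is none). The
initial private registers may have any size. Since messages of `0` qubits are allowed, protocols
with fewer than `r` rounds are covered. -/
noncomputable def quantumComplexity {X : Type*} (r : ℕ) (G : SimpleGraph X) : ℕ∞ :=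
  ⨅ (k : ℕ) (m : ℕ) (P : QProtocol X r k m) (_ : P.Solves G), (P.cost : ℕ∞)

/-- The graph on `{0,1}^n` in which two distinct strings are adjacent if they differ in exactly `d`
positions. Its promise equality problem is EQ-`(n choose d)`. -/
def hammingGraph (n d : ℕ) : SimpleGraph (Bits n) where
  Adj x y := x ≠ y ∧ hammingDist x y = d
  symm := ⟨fun x y h => ⟨h.1.symm, by rw [hammingDist_comm]; exact h.2⟩⟩
  loopless := ⟨fun _ h => h.1 rfl⟩

/-! Lower bound. After a one-round protocol, fix a basis state of the qubits that the sender keeps,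
chosen so that the conditional message vector is nonzero. Exactness makes the message vectors of
adjacent inputs orthogonal (`BinaryMeasurement.dotProduct_eq_zero`), so `l` message qubits give an
orthogonal representation of the distance-`n/4` graph in dimension `2^l`, whatever the size of the
private registers. The normalised rank-one projections on these vectors are orthonormal along edges
and have inner product `1` with the identity matrix, whose squared norm is `2^l`. The ratio bound
`krawtchouk_zero_le_mul_norm_sq` then gives `K(0) ≤ μ * 2^l`, where the Krawtchouk values `K(j)` are
the eigenvalues of the graph and `-μ` bounds them from below.

It remains to bound `μ`. For `j` within `n/15` of either end, `K(j)` is positive (`krawtchouk_pos`,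
`krawtchouk_reflect`). For the other `j`, Parseval gives `K(j)^2 ≤ 2^n * C(n,d) / C(n,j)` with `d =
n/4`. Hence `C(n,n/4) * C(n,i) ≤ 2^(n+2l)` for every `i ≤ n/15`. With `i` close to `n/16` the left
side is exponentially larger than `2^n`, because the binary entropies of `1/4` and `1/16` add up to
more than `1`. So `l` is linear in `n`.

Upper bound. This is exact Grover search with one iteration. The first message encodes `x` in the
signs of a uniform superposition of positions. The receiver multiplies by the signs of `y` and
reflects about the uniform state. When exactly a quarter of the positions differ, the result is
supported on those positions. When `x = y` it stays uniform. Sending back a position `i` with the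
bit `y i` settles the question. -/

/-! ### Fourier analysis on the cube and the ratio bound for its distance graphs. -/

section WalshFourier

open Finset Polynomial

variable {α : Type*} [DecidableEq α]

/-- The Walsh character `T ↦ (-1)^|S ∩ T|` of the Boolean cube. -/
def walsh (S T : Finset α) : ℝ := ∏ i ∈ S, if i ∈ T then -1 else 1

theorem walsh_mul_walsh (S T T' : Finset α) :
    walsh S T * walsh S T' = walsh S (symmDiff T T') := by
  unfold walsh
  rw [← prod_mul_distrib]
  refine prod_congr rfl fun i _ => ?_
  by_cases h : i ∈ T <;> by_cases h' : i ∈ T' <;> simp [mem_symmDiff, h, h']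

theorem walsh_empty_left (T : Finset α) : walsh ∅ T = 1 := by simp [walsh]

theorem walsh_comm (S T : Finset α) : walsh S T = walsh T S := by
  unfold walsh
  rw [← prod_filter_mul_prod_filter_not S (· ∈ T), ← prod_filter_mul_prod_filter_not T (· ∈ S)]
  rw [prod_congr (g := fun _ => (-1 : ℝ)) rfl (by simp +contextual),
    prod_congr (s₁ := S.filter (· ∉ T)) (g := fun _ => (1 : ℝ)) rfl (by simp +contextual),
    prod_congr (s₁ := T.filter (· ∈ S)) (g := fun _ => (-1 : ℝ)) rfl (by simp +contextual),
    prod_congr (s₁ := T.filter (· ∉ S)) (g := fun _ => (1 : ℝ)) rfl (by simp +contextual)]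
  simp only [filter_mem_eq_inter, prod_const, inter_comm, one_pow]

variable [Fintype α]

theorem sum_walsh (T : Finset α) :
    ∑ S, walsh S T = if T = ∅ then 2 ^ Fintype.card α else 0 := by
  have h := prod_one_add (s := (univ : Finset α)) (f := fun i => if i ∈ T then (-1 : ℝ) else 1)
  rw [powerset_univ] at h
  change _ = ∑ S, walsh S T at h
  rw [← h]
  split_ifs with hT
  · subst hT
    simp only [notMem_empty, if_false, prod_const, card_univ]
    norm_num
  · obtain ⟨i, hi⟩ := nonempty_iff_ne_empty.2 hT
    exact prod_eq_zero (mem_univ i) (by simp [hi])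

theorem sum_walsh_mul_walsh (T T' : Finset α) :
    ∑ S, walsh S T * walsh S T' = if T = T' then 2 ^ Fintype.card α else 0 := by
  simp only [walsh_mul_walsh, sum_walsh, ← bot_eq_empty, symmDiff_eq_bot]

/-- The value at `j` of the Krawtchouk polynomial of degree `d` for the `n`-cube. -/
noncomputable def krawtchouk (n d j : ℕ) : ℝ := ((1 - X) ^ j * (1 + X) ^ (n - j) : ℝ[X]).coeff d

/-- The left side is an elementary symmetric function of signs, `#S` of which are `-1`, hence a
coefficient of the product of the factors `1 ± X`. -/
theorem sum_walsh_powersetCard (d : ℕ) (S : Finset α) :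
    ∑ T ∈ powersetCard d univ, walsh S T = krawtchouk (Fintype.card α) d #S := by
  have h := prod_one_add (s := (univ : Finset α))
    (f := fun i => C (if i ∈ S then (-1 : ℝ) else 1) * X)
  have h1 : ∏ i : α, (1 + C (if i ∈ S then (-1 : ℝ) else 1) * X)
      = (1 - X) ^ #S * (1 + X) ^ (Fintype.card α - #S) := by
    rw [← prod_mul_prod_compl S,
      prod_congr (g := fun _ => (1 - X : ℝ[X])) rfl
        (fun i hi => by simp [hi, sub_eq_add_neg]),
      prod_congr (s₁ := Sᶜ) (g := fun _ => (1 + X : ℝ[X])) rfl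
        (fun i hi => by simp [mem_compl.1 hi])]
    simp [card_compl]
  rw [krawtchouk, ← h1, h, powerset_univ, finsetSum_coeff]
  have h2 : ∀ T : Finset α, (∏ i ∈ T, (C (if i ∈ S then (-1 : ℝ) else 1) * X)).coeff d
      = if #T = d then walsh S T else 0 := by
    intro T
    rw [prod_mul_distrib, prod_const, ← map_prod, coeff_C_mul, coeff_X_pow, walsh_comm, walsh]
    simp [eq_comm]
  simp only [h2]
  rw [← sum_filter, powersetCard_eq_filter, powerset_univ]

/-- Parseval: `krawtchouk` is the Walsh transform of the indicator of the `d`-subsets. -/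
theorem sum_krawtchouk_sq (d : ℕ) :
    ∑ S : Finset α, krawtchouk (Fintype.card α) d #S ^ 2
      = 2 ^ Fintype.card α * (Fintype.card α).choose d := by
  simp only [← sum_walsh_powersetCard, sq, sum_mul_sum]
  rw [sum_comm]
  simp only [sum_comm (s := (univ : Finset (Finset α)))]
  simp only [sum_walsh_mul_walsh]
  rw [sum_congr rfl fun T hT => by rw [sum_ite_eq, if_pos hT]]
  simp [mul_comm]

/-- Only the level `#S = j` of the Parseval sum is kept. -/
theorem choose_mul_krawtchouk_sq_le (n d j : ℕ) :
    n.choose j * krawtchouk n d j ^ 2 ≤ 2 ^ n * n.choose d := by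
  have h := sum_krawtchouk_sq (α := Fin n) d
  rw [Fintype.card_fin] at h
  rw [← h]
  calc (n.choose j : ℝ) * krawtchouk n d j ^ 2
      = ∑ S ∈ powersetCard j (univ : Finset (Fin n)), krawtchouk n d #S ^ 2 := by
        rw [sum_congr rfl fun S hS => by rw [(mem_powersetCard.1 hS).2]]
        simp
    _ ≤ _ := sum_le_sum_of_subset_of_nonneg (subset_univ _) fun _ _ _ => sq_nonneg _

/-- The spectral decomposition of the adjacency matrix of the distance-`d` graph: Walsh characters
are eigenvectors and Krawtchouk values are eigenvalues. -/
theorem sum_krawtchouk_mul_walsh (d : ℕ) (T T' : Finset α) :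
    ∑ S : Finset α, krawtchouk (Fintype.card α) d #S * (walsh S T * walsh S T')
      = if #(symmDiff T T') = d then 2 ^ Fintype.card α else 0 := by
  simp only [← sum_walsh_powersetCard, walsh_mul_walsh, sum_mul]
  rw [sum_comm]
  simp only [← walsh_mul_walsh _ _ (symmDiff T T')]
  simp only [sum_walsh_mul_walsh, sum_ite_eq', mem_powersetCard_univ]

variable {E : Type*} [NormedAddCommGroup E] [InnerProductSpace ℂ E]

theorem sum_krawtchouk_mul_norm_sq (d : ℕ) (p : Finset α → E) :
    ((∑ S : Finset α, krawtchouk (Fintype.card α) d #S * ‖∑ T, (walsh S T : ℂ) • p T‖ ^ 2 : ℝ) : ℂ)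
      = 2 ^ Fintype.card α *
        ∑ T, ∑ T', if #(symmDiff T T') = d then inner ℂ (p T) (p T') else 0 := by
  have h : ∀ S : Finset α, ((‖∑ T, (walsh S T : ℂ) • p T‖ ^ 2 : ℝ) : ℂ)
      = ∑ T, ∑ T', ((walsh S T * walsh S T' : ℝ) : ℂ) * inner ℂ (p T) (p T') := by
    intro S
    have := inner_self_eq_norm_sq_to_K (𝕜 := ℂ) (∑ T, (walsh S T : ℂ) • p T)
    rw [Complex.ofReal_pow]
    refine this.symm.trans ?_
    rw [sum_inner]
    refine sum_congr rfl fun T _ => ?_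
    rw [inner_sum]
    refine sum_congr rfl fun T' _ => ?_
    rw [inner_smul_left, inner_smul_right, Complex.conj_ofReal, Complex.ofReal_mul]
    ring
  rw [Complex.ofReal_sum]
  simp only [Complex.ofReal_mul, h, mul_sum]
  rw [sum_comm]
  refine sum_congr rfl fun T _ => ?_
  rw [sum_comm]
  refine sum_congr rfl fun T' _ => ?_
  have h' := congrArg (fun a : ℝ => (a : ℂ) * inner ℂ (p T) (p T'))
    (sum_krawtchouk_mul_walsh d T T')
  simp only [Complex.ofReal_sum, sum_mul] at h'
  convert h' using 1
  · refine sum_congr rfl fun S _ => ?_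
    push_cast; ring
  · split_ifs <;> simp

/-- The ratio bound for the distance-`d` graph of the cube, applied to unit vectors `p T` that are
orthogonal for vertices at distance `d` and have inner product `1` with a common vector `w`. -/
theorem krawtchouk_zero_le_mul_norm_sq {d : ℕ} {μ : ℝ} (hμ : 0 ≤ μ)
    (hK : ∀ j ≤ Fintype.card α, -μ ≤ krawtchouk (Fintype.card α) d j) (p : Finset α → E)
    (hp : ∀ T, ‖p T‖ = 1) (horth : ∀ T T', #(symmDiff T T') = d → inner ℂ (p T) (p T') = 0)
    (w : E) (hw : ∀ T, inner ℂ w (p T) = 1) :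
    krawtchouk (Fintype.card α) d 0 ≤ μ * ‖w‖ ^ 2 := by
  set q : Finset α → E := fun S => ∑ T, (walsh S T : ℂ) • p T with hq
  set N : ℝ := 2 ^ Fintype.card α with hN
  have hNpos : 0 < N := by positivity
  -- The quadratic form of the adjacency matrix vanishes, since only orthogonal pairs contribute.
  have h0 : ∑ S : Finset α, krawtchouk (Fintype.card α) d #S * ‖q S‖ ^ 2 = 0 := by
    have := sum_krawtchouk_mul_norm_sq d p
    rw [sum_eq_zero (fun T _ => sum_eq_zero fun T' _ => by
      split_ifs with h
      · exact horth T T' h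
      · rfl), mul_zero] at this
    exact_mod_cast this
  -- Distance `0` turns the same identity into Parseval, as all the eigenvalues are then `1`.
  have h1 : ∑ S : Finset α, ‖q S‖ ^ 2 = N * N := by
    have := sum_krawtchouk_mul_norm_sq 0 p
    have hk : ∀ j, krawtchouk (Fintype.card α) 0 j = 1 := by
      intro j
      simp [krawtchouk, coeff_zero_eq_eval_zero]
    simp only [hk, one_mul, card_eq_zero, ← bot_eq_empty, symmDiff_eq_bot, sum_ite_eq, mem_univ,
      if_true, inner_self_eq_norm_sq_to_K, hp] at this
    have h2 : ((∑ S : Finset α, ‖q S‖ ^ 2 : ℝ) : ℂ) = ((N * N : ℝ) : ℂ) := by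
      rw [this]
      simp [hN]
    exact_mod_cast h2
  have h2 : N ≤ ‖w‖ * ‖q ∅‖ := by
    have : inner ℂ w (q ∅) = (N : ℂ) := by
      simp [hq, walsh_empty_left, hw, hN]
    have h := norm_inner_le_norm (𝕜 := ℂ) w (q ∅)
    rwa [this, Complex.norm_real, Real.norm_of_nonneg hNpos.le] at h
  -- After the shift by `μ` all the terms are nonnegative, so the term of the trivial character is
  -- at most the whole sum.
  have h3 : krawtchouk (Fintype.card α) d 0 * ‖q ∅‖ ^ 2 ≤ μ * (N * N) := by
    calc krawtchouk (Fintype.card α) d 0 * ‖q ∅‖ ^ 2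
        ≤ (krawtchouk (Fintype.card α) d #(∅ : Finset α) + μ) * ‖q ∅‖ ^ 2 := by
          rw [card_empty]
          gcongr
          linarith
      _ ≤ ∑ S : Finset α, (krawtchouk (Fintype.card α) d #S + μ) * ‖q S‖ ^ 2 :=
          single_le_sum (f := fun S => (krawtchouk (Fintype.card α) d #S + μ) * ‖q S‖ ^ 2)
            (fun S _ => mul_nonneg (by linarith [hK #S (card_le_univ S)]) (sq_nonneg _))
            (mem_univ _)
      _ = μ * (N * N) := by
          simp only [add_mul, sum_add_distrib, h0, ← mul_sum, h1, zero_add]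
  have hq0 : 0 < ‖q ∅‖ ^ 2 := by
    have : 0 < ‖w‖ * ‖q ∅‖ := lt_of_lt_of_le hNpos h2
    have := pos_of_mul_pos_right this (norm_nonneg w)
    positivity
  refine le_of_mul_le_mul_right (h3.trans ?_) hq0
  have : N * N ≤ (‖w‖ * ‖q ∅‖) * (‖w‖ * ‖q ∅‖) := mul_le_mul h2 h2 hNpos.le (by positivity)
  calc μ * (N * N) ≤ μ * ((‖w‖ * ‖q ∅‖) * (‖w‖ * ‖q ∅‖)) := by gcongr
    _ = _ := by ring

end WalshFourier

/-! ### Lower bounds for Krawtchouk values at `d = n/4`, and growth of binomial coefficients. -/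

section Krawtchouk

open Polynomial

theorem coeff_X_mul_derivative' (p : ℝ[X]) (d : ℕ) :
    (X * derivative p).coeff d = d * p.coeff d := by
  cases d with
  | zero => simp
  | succ d => rw [coeff_X_mul, coeff_derivative]; push_cast; ring

theorem krawtchouk_zero_right (n d : ℕ) : krawtchouk n d 0 = n.choose d := by
  simp [krawtchouk, coeff_one_add_X_pow]

theorem krawtchouk_one_right (n d : ℕ) (hn : 0 < n) :
    n * krawtchouk n d 1 = (n - 2 * d) * krawtchouk n d 0 := by
  obtain ⟨b, rfl⟩ := Nat.exists_eq_succ_of_ne_zero hn.ne'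
  simp only [krawtchouk]
  set p : ℝ[X] := (1 - X) ^ 0 * (1 + X) ^ (b.succ - 0) with hp
  have h : C ((b.succ : ℕ) : ℝ) * ((1 - X) ^ 1 * (1 + X) ^ (b.succ - 1))
      = C ((b.succ : ℕ) : ℝ) * p - C 2 * (X * derivative p) := by
    simp only [hp, pow_zero, one_mul, Nat.sub_zero, derivative_pow, derivative_add, derivative_one,
      derivative_X, Nat.succ_sub_one, pow_one, C_ofNat]
    simp
    ring
  have h' := congrArg (coeff · d) h
  simp only [coeff_sub, coeff_C_mul, coeff_X_mul_derivative'] at h'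
  rw [h']
  ring

/-- For `p = (1-X)^j (1+X)^(n-j)`, the polynomial `n p - 2 X p'` is a combination of the generating
functions at `j + 1` and `j - 1`. The operator `X d/dX` multiplies the coefficient of `X^d` by `d`.
-/
theorem krawtchouk_recurrence (n d j : ℕ) (hj : 0 < j) (hjn : j < n) :
    (n - j) * krawtchouk n d (j + 1)
      = (n - 2 * d) * krawtchouk n d j - j * krawtchouk n d (j - 1) := by
  obtain ⟨a, rfl⟩ := Nat.exists_eq_succ_of_ne_zero hj.ne'
  obtain ⟨b, rfl⟩ := Nat.exists_eq_add_of_lt hjn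
  simp only [krawtchouk]
  rw [show a.succ + b + 1 - (a.succ + 1) = b by omega,
    show a.succ + b + 1 - a.succ = b + 1 by omega,
    show a.succ + b + 1 - (a.succ - 1) = b + 2 by omega, Nat.succ_sub_one]
  set p : ℝ[X] := (1 - X) ^ a.succ * (1 + X) ^ (b + 1) with hp
  have h : C ((b : ℝ) + 1) * ((1 - X) ^ (a.succ + 1) * (1 + X) ^ b)
      = C ((a : ℝ) + b + 2) * p - C 2 * (X * derivative p)
        - C ((a : ℝ) + 1) * ((1 - X) ^ a * (1 + X) ^ (b + 2)) := by
    simp only [hp, derivative_mul, derivative_pow, derivative_add, derivative_sub, derivative_one,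
      derivative_X, Nat.succ_eq_add_one, Nat.add_sub_cancel]
    simp [show (C 2 : ℝ[X]) = 2 from rfl]
    ring
  have h' := congrArg (coeff · d) h
  simp only [coeff_sub, coeff_C_mul, coeff_X_mul_derivative'] at h'
  push_cast
  linear_combination h'

/-- The substitution `X ↦ -X` exchanges the two factors and fixes the coefficients of even degree.
-/
theorem krawtchouk_reflect {n d j : ℕ} (hd : Even d) (hj : j ≤ n) :
    krawtchouk n d (n - j) = krawtchouk n d j := by
  simp only [krawtchouk]
  rw [Nat.sub_sub_self hj]
  have h : ((1 - X) ^ (n - j) * (1 + X) ^ j : ℝ[X])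
      = ((1 - X) ^ j * (1 + X) ^ (n - j) : ℝ[X]).comp (C (-1) * X) := by
    simp
    ring
  rw [h, comp_C_mul_X_coeff, hd.neg_one_pow, mul_one]

/-- The ratio bound propagates itself: if `K(j-1) ≤ 4 K(j)`, the recurrence gives `(n-j) K(j+1) ≥
(n/2 - 4j) K(j)`, and `n/2 - 4j ≥ (n-j)/4` holds exactly when `15 j ≤ n`. -/
theorem krawtchouk_pos {n d : ℕ} (hn : n = 4 * d) (hd : 0 < d) (j : ℕ) (hj : 15 * j ≤ n) :
    0 < krawtchouk n d j ∧ krawtchouk n d j ≤ 4 * krawtchouk n d (j + 1) := by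
  have hnd : (n : ℝ) = 4 * d := by exact_mod_cast hn
  have hd' : (0 : ℝ) < d := by exact_mod_cast hd
  induction j with
  | zero =>
    have h0 : 0 < krawtchouk n d 0 := by
      rw [krawtchouk_zero_right]
      exact_mod_cast Nat.choose_pos (by omega)
    refine ⟨h0, ?_⟩
    have h1 := krawtchouk_one_right n d (by omega)
    rw [hnd] at h1
    have : krawtchouk n d 0 = 2 * krawtchouk n d 1 := by
      have : (d : ℝ) * (krawtchouk n d 0 - 2 * krawtchouk n d 1) = 0 := by linarith
      linarith [(mul_eq_zero.1 this).resolve_left hd'.ne']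
    simp only [zero_add]
    linarith
  | succ j ih =>
    obtain ⟨h0, h1⟩ := ih (by omega)
    have hpos : 0 < krawtchouk n d (j + 1) := by linarith
    refine ⟨hpos, ?_⟩
    have hr := krawtchouk_recurrence n d (j + 1) (by omega) (by omega)
    rw [Nat.add_sub_cancel] at hr
    have hj' : 15 * ((j : ℝ) + 1) ≤ n := by exact_mod_cast hj
    have hnj : (0 : ℝ) < n - (j + 1) := by linarith
    push_cast at hr
    refine le_of_mul_le_mul_left ?_ hnj
    have e1 : ((j : ℝ) + 1) * krawtchouk n d j ≤ (j + 1) * (4 * krawtchouk n d (j + 1)) := by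
      gcongr
    have e2 : 15 * ((j : ℝ) + 1) * krawtchouk n d (j + 1) ≤ n * krawtchouk n d (j + 1) := by
      gcongr
    have e3 : ((n : ℝ) - 2 * d) * krawtchouk n d (j + 1) = n / 2 * krawtchouk n d (j + 1) := by
      rw [hnd]; ring
    linarith

theorem Nat.choose_le_choose_of_le_half {n i j : ℕ} (hij : i ≤ j) (hj : 2 * j ≤ n) :
    n.choose i ≤ n.choose j := by
  induction j, hij using Nat.le_induction with
  | base => rfl
  | succ j _ ih =>
    exact (ih (by omega)).trans (Nat.choose_le_succ_of_lt_half_left (by omega))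

theorem Nat.choose_le_choose_of_mem_Icc {n i j : ℕ} (hij : i ≤ j) (hj : i + j ≤ n) :
    n.choose i ≤ n.choose j := by
  rcases le_total (2 * j) n with h | h
  · exact Nat.choose_le_choose_of_le_half hij h
  · rw [← Nat.choose_symm (by omega : j ≤ n)]
    exact Nat.choose_le_choose_of_le_half (by omega) (by omega)

/-- Values near both ends are positive. In between `i < j < n - i`, so `C(n,j) ≥ C(n,i)` and the
Parseval bound applies. -/
theorem neg_sqrt_le_krawtchouk {n d i j : ℕ} (hn : n = 4 * d) (hd : 0 < d) (hde : Even d)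
    (hi : 15 * i ≤ n) (hj : j ≤ n) :
    -√(2 ^ n * n.choose d / n.choose i) ≤ krawtchouk n d j := by
  rcases le_or_gt j i with h | h
  · exact (neg_nonpos.2 (Real.sqrt_nonneg _)).trans (krawtchouk_pos hn hd j (by omega)).1.le
  rcases le_or_gt (n - j) i with h' | h'
  · rw [← krawtchouk_reflect hde hj]
    exact (neg_nonpos.2 (Real.sqrt_nonneg _)).trans (krawtchouk_pos hn hd _ (by omega)).1.le
  refine neg_le_of_abs_le (Real.abs_le_sqrt ?_)
  have hc : (n.choose i : ℝ) ≤ n.choose j := by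
    exact_mod_cast Nat.choose_le_choose_of_mem_Icc h.le (by omega)
  have hpos : (0 : ℝ) < n.choose i := by exact_mod_cast Nat.choose_pos (by omega)
  rw [le_div_iff₀ hpos, mul_comm]
  exact (mul_le_mul_of_nonneg_right hc (sq_nonneg _)).trans (choose_mul_krawtchouk_sq_le n d j)

theorem Nat.choose_mul_choose_le_choose_add (a b c d : ℕ) :
    a.choose b * c.choose d ≤ (a + c).choose (b + d) := by
  rw [Nat.add_choose_eq]
  exact Finset.single_le_sum (f := fun ij : ℕ × ℕ => a.choose ij.1 * c.choose ij.2)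
    (fun _ _ => Nat.zero_le _) (a := (b, d)) (by simp)

/-- This reduces exponential lower bounds to one numerical binomial coefficient for blocks of a
fixed size. -/
theorem Nat.choose_pow_le_choose_mul (a b q : ℕ) :
    a.choose b ^ q ≤ (a * q).choose (b * q) := by
  induction q with
  | zero => simp
  | succ q ih =>
    rw [pow_succ, Nat.mul_succ, Nat.mul_succ]
    exact (Nat.mul_le_mul_right _ ih).trans (Nat.choose_mul_choose_le_choose_add _ _ _ _)

end Krawtchouk

/-! ### Dimension of orthogonal representations. -/

section OrthogonalRank

open Finset

/-- The vectors `v T` need not share a common vector as the ratio bound requires, but the matrices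
`v v* / ‖v‖²` do: each has trace `1`, which is its Hilbert–Schmidt product with the identity. Their
mutual products are the squared overlaps of the normalised vectors. -/
theorem card_le_sqrt_mul_of_orthogonal {α ι : Type*} [DecidableEq α] [Fintype α] [Fintype ι]
    {d : ℕ} {μ : ℝ} (hμ : 0 ≤ μ)
    (hK : ∀ j ≤ Fintype.card α, -μ ≤ krawtchouk (Fintype.card α) d j)
    (v : Finset α → ι → ℂ) (hv : ∀ T, v T ≠ 0)
    (horth : ∀ T T', #(symmDiff T T') = d → star (v T) ⬝ᵥ v T' = 0) :
    krawtchouk (Fintype.card α) d 0 ≤ μ * Fintype.card ι := by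
  classical
  set c : Finset α → ℂ := fun T => star (v T) ⬝ᵥ v T with hc
  have hc0 : ∀ T, c T ≠ 0 := fun T h => hv T (dotProduct_star_self_eq_zero.1 h)
  have hcstar : ∀ T, star (c T) = c T := fun T => by
    rw [hc]
    exact (Matrix.star_dotProduct _ _).symm
  set p : Finset α → EuclideanSpace ℂ (ι × ι) := fun T =>
    WithLp.toLp 2 fun ab => (c T)⁻¹ * (v T ab.1 * star (v T ab.2)) with hp
  have hpp : ∀ T T', inner ℂ (p T) (p T')
      = (c T)⁻¹ * (c T')⁻¹ * ((star (v T) ⬝ᵥ v T') * star (star (v T) ⬝ᵥ v T')) := by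
    intro T T'
    simp only [hp, PiLp.inner_apply, RCLike.inner_apply, dotProduct, star_sum,
      Fintype.sum_prod_type, Pi.star_apply, star_mul', star_star, starRingEnd_apply, star_inv₀,
      hcstar]
    rw [sum_mul_sum, mul_sum]
    simp only [mul_sum]
    refine sum_congr rfl fun a _ => sum_congr rfl fun b _ => ?_
    ring
  set w : EuclideanSpace ℂ (ι × ι) := WithLp.toLp 2 fun ab => if ab.1 = ab.2 then 1 else 0 with hw
  have hwn : ‖w‖ ^ 2 = Fintype.card ι := by
    rw [EuclideanSpace.norm_sq_eq, Fintype.sum_prod_type]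
    simp [hw, apply_ite]
  rw [← hwn]
  refine krawtchouk_zero_le_mul_norm_sq hμ hK p (fun T => ?_) (fun T T' h => ?_) w (fun T => ?_)
  · have h : inner ℂ (p T) (p T) = 1 := by
      rw [hpp]
      change (c T)⁻¹ * (c T)⁻¹ * (c T * star (c T)) = 1
      rw [hcstar]
      field_simp [hc0 T]
    rw [inner_self_eq_norm_sq_to_K] at h
    have h' : ‖p T‖ ^ 2 = 1 := Complex.ofReal_injective (by
      rw [Complex.ofReal_pow, Complex.ofReal_one]
      exact h)
    exact (pow_eq_one_iff_of_nonneg (norm_nonneg _) two_ne_zero).1 h'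
  · rw [hpp, horth T T' h]; simp
  · simp only [hw, hp, PiLp.inner_apply, RCLike.inner_apply, Fintype.sum_prod_type, apply_ite,
      map_one, map_zero, mul_one, mul_zero, sum_ite_eq, mem_univ, if_true]
    rw [← mul_sum]
    have : ∑ a, v T a * star (v T a) = c T := by
      simp [hc, dotProduct, mul_comm]
    rw [this, inv_mul_cancel₀ (hc0 T)]

theorem hammingDist_decide_mem {n : ℕ} (T T' : Finset (Fin n)) :
    hammingDist (fun i => decide (i ∈ T)) (fun i => decide (i ∈ T')) = #(symmDiff T T') := by
  unfold hammingDist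
  congr 1
  ext i
  by_cases h : i ∈ T <;> by_cases h' : i ∈ T' <;> simp [mem_symmDiff, h, h']

/-- An orthogonal representation in `ℂ ^ (2 ^ l)` forces `l` to be linear in `n`. -/
theorem le_of_orthogonal_representation {n l : ℕ} (hn : 0 < n) (h8 : 8 ∣ n)
    (v : Bits n → Bits l → ℂ) (hv : ∀ x, v x ≠ 0)
    (horth : ∀ x y, (hammingGraph n (n / 4)).Adj x y → star (v x) ⬝ᵥ v y = 0) :
    n ≤ 1300 * l := by
  obtain ⟨m, rfl⟩ := h8
  have hd4 : 8 * m / 4 = 2 * m := by omega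
  rw [hd4] at horth
  have hadj : ∀ T T' : Finset (Fin (8 * m)), #(symmDiff T T') = 2 * m →
      (hammingGraph (8 * m) (2 * m)).Adj (fun i => decide (i ∈ T)) (fun i => decide (i ∈ T')) := by
    intro T T' h
    rw [← hammingDist_decide_mem] at h
    refine ⟨fun he => ?_, h⟩
    rw [he, hammingDist_self] at h
    omega
  -- For `l = 0` the space is a line, where the nonzero vectors at the ends of an edge cannot be
  -- orthogonal. The bound `1 ≤ l` later absorbs the rounding loss.
  have hl : 1 ≤ l := by
    by_contra! hl
    obtain rfl : l = 0 := by omega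
    obtain ⟨T, -, hT⟩ := exists_subset_card_eq (s := (univ : Finset (Fin (8 * m)))) (n := 2 * m)
      (by simp; omega)
    have h := horth _ _ (hadj ∅ T (by rwa [← bot_eq_empty, bot_symmDiff]))
    rw [dotProduct, Fintype.sum_unique] at h
    have hz : ∀ x a, v x a = 0 → False := fun x a hx =>
      hv x (funext fun b => (congrArg (v x) (Subsingleton.elim b a)).trans hx)
    rcases mul_eq_zero.1 h with h | h
    · rw [Pi.star_apply] at h
      exact hz _ _ (star_eq_zero.1 h)
    · exact hz _ _ h
  -- The level `i = 4 * q` is about `n/16` and satisfies `15 * i = 60 * q ≤ n`.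
  set q := 8 * m / 64 with hq
  have hn64 : 64 * q ≤ 8 * m := by omega
  have hKr := card_le_sqrt_mul_of_orthogonal (α := Fin (8 * m)) (d := 2 * m)
    (Real.sqrt_nonneg (2 ^ (8 * m) * (8 * m).choose (2 * m) / (8 * m).choose (4 * q)))
    (by
      rw [Fintype.card_fin]
      exact fun j hj => neg_sqrt_le_krawtchouk (by omega) (by omega) (even_two_mul m) (by omega) hj)
    (fun T => v fun i => decide (i ∈ T)) (fun T => hv _) (fun T T' h => horth _ _ (hadj T T' h))
  rw [Fintype.card_fin, krawtchouk_zero_right] at hKr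
  have hA : (0 : ℝ) < (8 * m).choose (2 * m) := by exact_mod_cast Nat.choose_pos (by omega)
  have hB : (0 : ℝ) < (8 * m).choose (4 * q) := by exact_mod_cast Nat.choose_pos (by omega)
  have hmain : ((8 * m).choose (2 * m) * (8 * m).choose (4 * q) : ℝ) ≤ 2 ^ (8 * m + 2 * l) := by
    have h2 := pow_le_pow_left₀ hA.le hKr 2
    rw [mul_pow, Real.sq_sqrt (by positivity)] at h2
    simp only [Fintype.card_fun, Fintype.card_bool, Fintype.card_fin, Nat.cast_pow,
      Nat.cast_ofNat] at h2
    rw [div_mul_eq_mul_div, le_div_iff₀ hB] at h2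
    refine le_of_mul_le_mul_left ?_ hA
    calc _ = ((8 * m).choose (2 * m) : ℝ) ^ 2 * (8 * m).choose (4 * q) := by ring
      _ ≤ _ := h2
      _ = _ := by rw [pow_add, mul_comm 2 l, pow_mul]; ring
  have hmain' : (8 * m).choose (2 * m) * (8 * m).choose (4 * q) ≤ 2 ^ (8 * m + 2 * l) := by
    exact_mod_cast hmain
  -- Numerically `C(64,16) ≥ 2^48` and `C(64,4) ≥ 2^19`. What matters is that `48 + 19` exceeds
  -- `64`.
  have hA' : 2 ^ (48 * q) ≤ (8 * m).choose (2 * m) := by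
    calc 2 ^ (48 * q) ≤ (Nat.choose 64 16) ^ q := by
          rw [pow_mul]; exact Nat.pow_le_pow_left (by norm_num [Nat.choose]) q
      _ ≤ (64 * q).choose (16 * q) * (8 * m - 64 * q).choose (2 * m - 16 * q) :=
          (Nat.choose_pow_le_choose_mul 64 16 q).trans
            (Nat.le_mul_of_pos_right _ (Nat.choose_pos (by omega)))
      _ ≤ _ := Nat.choose_mul_choose_le_choose_add _ _ _ _
      _ = _ := by congr 1 <;> omega
  have hB' : 2 ^ (19 * q) ≤ (8 * m).choose (4 * q) := by
    calc 2 ^ (19 * q) ≤ (Nat.choose 64 4) ^ q := by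
          rw [pow_mul]; exact Nat.pow_le_pow_left (by norm_num [Nat.choose]) q
      _ ≤ (64 * q).choose (4 * q) := Nat.choose_pow_le_choose_mul 64 4 q
      _ ≤ _ := Nat.choose_le_choose _ hn64
  have hexp : 48 * q + 19 * q ≤ 8 * m + 2 * l := by
    refine (Nat.pow_le_pow_iff_right (a := 2) (by norm_num)).1 ?_
    rw [pow_add]
    exact (Nat.mul_le_mul hA' hB').trans hmain'
  -- Since `8 * m ≤ 64 * q + 56`, the inequality gives `3 * q ≤ 2 * l + 56`. The resulting additive
  -- constant is covered by `1300 * l` because `l ≥ 1`.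
  omega

end OrthogonalRank

/-! ### From one-round protocols to orthogonal representations. -/

section OneRound

open Matrix

theorem BinaryMeasurement.prob_add_prob {k m : ℕ} (M : BinaryMeasurement k) (ψ : JointState k m) :
    M.prob ψ true + M.prob ψ false = (∑ t, star (fun s => ψ s t) ⬝ᵥ (fun s => ψ s t)).re := by
  rw [BinaryMeasurement.prob, BinaryMeasurement.prob, ← Complex.add_re, ← Finset.sum_add_distrib]
  congr 1
  refine Finset.sum_congr rfl fun t _ => ?_
  rw [← dotProduct_add, ← Matrix.add_mulVec, M.sum_eq_one, Matrix.one_mulVec]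

/-- An outcome of probability zero has an effect that vanishes on the measured state. -/
theorem BinaryMeasurement.mulVec_eq_zero_of_prob_eq_zero {k m : ℕ} (M : BinaryMeasurement k)
    (ψ : JointState k m) (o : Bool) (h : M.prob ψ o = 0) (t : Bits m) :
    (M.effect o) *ᵥ (fun s => ψ s t) = 0 := by
  have hnn : ∀ t ∈ Finset.univ,
      0 ≤ star (fun s => ψ s t) ⬝ᵥ (M.effect o) *ᵥ (fun s => ψ s t) :=
    fun t _ => (M.posSemidef o).dotProduct_mulVec_nonneg _
  have hs := Finset.sum_nonneg hnn
  have h0 : ∑ t, star (fun s => ψ s t) ⬝ᵥ (M.effect o) *ᵥ (fun s => ψ s t) = 0 :=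
    Complex.ext h (Complex.nonneg_iff.1 hs).2.symm
  rw [Finset.sum_eq_zero_iff_of_nonneg hnn] at h0
  exact ((M.posSemidef o).dotProduct_mulVec_zero_iff _).1 (h0 t (Finset.mem_univ t))

/-- States on which a measurement surely gives opposite outcomes are orthogonal. -/
theorem BinaryMeasurement.dotProduct_eq_zero {k : ℕ} (M : BinaryMeasurement k) {a b : Bits k → ℂ}
    (ha : (M.effect true) *ᵥ a = 0) (hb : (M.effect false) *ᵥ b = 0) : star a ⬝ᵥ b = 0 := by
  have hb' : (M.effect true) *ᵥ b = b := by
    have := congrArg (· *ᵥ b) M.sum_eq_one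
    simpa only [Matrix.add_mulVec, hb, add_zero, Matrix.one_mulVec] using this
  have hH := (M.posSemidef true).isHermitian.eq
  rw [← hb', dotProduct_mulVec, ← hH, ← Matrix.star_mulVec, ha, star_zero, zero_dotProduct]

theorem sendQubits_zero {k m l : ℕ} (U : Matrix (Bits k × Bits l) (Bits k × Bits l) ℂ)
    (w : Bits (m + l)) (s : Bits k) :
    sendQubits U (JointState.zero k m) w s
      = if (fun i => w (Fin.castAdd l i)) = (fun _ => false)
        then U (s, fun i => w (Fin.natAdd m i)) (fun _ => false, fun _ => false) else 0 := by
  unfold sendQubits JointState.zero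
  rw [Finset.sum_eq_single (fun _ => false)]
  · simp
  · intro s' _ hs'
    simp [hs']
  · simp

theorem Bits.sum_add {M : Type*} [AddCommMonoid M] {m l : ℕ} (f : Bits (m + l) → M) :
    ∑ w, f w = ∑ a : Bits m, ∑ b : Bits l, f (Fin.append a b) := by
  rw [← Fintype.sum_prod_type']
  exact (Fintype.sum_equiv (Fin.appendEquiv m l) _ _ fun _ => rfl).symm

/-- The receiver's own qubits are still zero, so overlaps of conditional states only involve the `l`
message qubits. The kept states `s` and `s'` may differ. -/
theorem sum_dotProduct_sendQubits_zero {k m l : ℕ}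
    (U : Matrix (Bits k × Bits l) (Bits k × Bits l) ℂ)
    (U' : Matrix (Bits k × Bits l) (Bits k × Bits l) ℂ) (s s' : Bits k) :
    star (fun w => sendQubits U (JointState.zero k m) w s)
        ⬝ᵥ (fun w => sendQubits U' (JointState.zero k m) w s')
      = star (fun b => U (s, b) (fun _ => false, fun _ => false))
        ⬝ᵥ (fun b => U' (s', b) (fun _ => false, fun _ => false)) := by
  simp only [dotProduct, Bits.sum_add, Pi.star_apply, sendQubits_zero, Fin.append_left,
    Fin.append_right]
  rw [Finset.sum_eq_single (fun _ => false)]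
  · simp
  · intro a _ ha
    simp [ha]
  · simp

theorem sum_dotProduct_column {k l : ℕ} (U : unitaryGroup (Bits k × Bits l) ℂ)
    (c : Bits k × Bits l) :
    ∑ s, star (fun b => U.1 (s, b) c) ⬝ᵥ (fun b => U.1 (s, b) c)
      = 1 := by
  have h := congrFun (congrFun (mem_unitaryGroup_iff'.1 U.2) c) c
  rw [Matrix.mul_apply, Fintype.sum_prod_type, Matrix.one_apply_eq] at h
  simpa [dotProduct, Matrix.star_apply] using h

/-- A sure outcome makes the opposite effect annihilate every conditional vector, not only the
global state. One nonzero conditional vector can therefore be picked for each input independently.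
-/
theorem le_cost_of_solves_one {n k m : ℕ} (hn : 0 < n) (h8 : 8 ∣ n) (P : QProtocol (Bits n) 1 k m)
    (hP : P.Solves (hammingGraph n (n / 4))) : n ≤ 1300 * P.cost := by
  cases P with
  | send l U next =>
  cases next with
  | output M =>
  obtain ⟨h1, h2⟩ := hP
  set ψ : Bits n → JointState (m + l) k := fun x =>
    sendQubits (U x).1 (JointState.zero k m) with hψ
  have e1 : ∀ x, (M x).prob (ψ x) true = 1 := h1
  have e2 : ∀ x y, (hammingGraph n (n / 4)).Adj x y → (M y).prob (ψ x) false = 1 := h2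
  have hnorm : ∀ x y, (M y).prob (ψ x) true + (M y).prob (ψ x) false = 1 := by
    intro x y
    rw [BinaryMeasurement.prob_add_prob]
    simp only [hψ, sum_dotProduct_sendQubits_zero, sum_dotProduct_column, Complex.one_re]
  have hex : ∀ x, ∃ s, (fun b => (U x).1 (s, b) (fun _ => false, fun _ => false)) ≠ 0 := by
    intro x
    by_contra! h
    have := sum_dotProduct_column (U x) (fun _ => false, fun _ => false)
    simp [h] at this
  choose s hs using hex
  have : (QProtocol.send l U (QProtocol.output M) : QProtocol (Bits n) 1 k m).cost = l := rfl
  rw [this]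
  refine le_of_orthogonal_representation hn h8 _ hs fun x y hxy => ?_
  rw [← sum_dotProduct_sendQubits_zero (m := m)]
  refine (M y).dotProduct_eq_zero
    ((M y).mulVec_eq_zero_of_prob_eq_zero (ψ x) true ?_ (s x))
    ((M y).mulVec_eq_zero_of_prob_eq_zero (ψ y) false ?_ (s y))
  · linarith [hnorm x y, e2 x y hxy]
  · linarith [hnorm y y, e1 y]

theorem le_quantumComplexity_one {n : ℕ} (hn : 0 < n) (h8 : 8 ∣ n) :
    ENNReal.ofReal (1 / 1300 * n) ≤ (quantumComplexity 1 (hammingGraph n (n / 4)) : ℝ≥0∞) := by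
  have h : ((⌈(1 / 1300 * n : ℝ)⌉₊ : ℕ) : ℕ∞) ≤ quantumComplexity 1 (hammingGraph n (n / 4)) := by
    refine le_iInf fun k => le_iInf fun m => le_iInf fun P => le_iInf fun hP => ?_
    rw [Nat.cast_le, Nat.ceil_le]
    have := le_cost_of_solves_one hn h8 P hP
    have : (n : ℝ) ≤ 1300 * P.cost := by exact_mod_cast this
    linarith
  refine le_trans ?_ (ENat.toENNReal_le.2 h)
  rw [ENat.toENNReal_coe, ENNReal.ofReal_le_natCast]
  exact Nat.le_ceil _

end OneRound

/-! ### The two-round protocol. -/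

section TwoRound

open Matrix

/-- Every family of orthonormal vectors is the set of columns of a unitary matrix. -/
theorem exists_unitary_with_columns {κ ι : Type*} [DecidableEq κ] [Fintype ι] [DecidableEq ι]
    (f : κ ↪ ι) (W : κ → ι → ℂ) (hW : ∀ i j, star (W i) ⬝ᵥ W j = if i = j then 1 else 0) :
    ∃ U : unitaryGroup ι ℂ, ∀ a i, U.1 a (f i) = W i a := by
  classical
  let v : ι → EuclideanSpace ℂ ι := fun c =>
    if h : ∃ i, f i = c then WithLp.toLp 2 (W h.choose) else 0
  have hv : ∀ i, v (f i) = WithLp.toLp 2 (W i) := by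
    intro i
    have h : ∃ j, f j = f i := ⟨i, rfl⟩
    simp only [v, dif_pos h, f.injective h.choose_spec]
  have ho : Orthonormal ℂ ((Set.range f).domRestrict v) := by
    rw [orthonormal_iff_ite]
    rintro ⟨_, i, rfl⟩ ⟨_, j, rfl⟩
    change inner ℂ (v (f i)) (v (f j)) = _
    rw [hv, hv]
    rw [EuclideanSpace.inner_toLp_toLp, dotProduct_comm, hW]
    exact if_congr ⟨fun h => Subtype.ext (congrArg f h),
      fun h => f.injective (congrArg Subtype.val h)⟩ rfl rfl
  obtain ⟨b, hb⟩ := ho.exists_orthonormalBasis_extension_of_card_eq (by simp)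
  refine ⟨⟨(EuclideanSpace.basisFun ι ℂ).toBasis.toMatrix b,
    (EuclideanSpace.basisFun ι ℂ).toMatrix_orthonormalBasis_mem_unitary b⟩, fun a i => ?_⟩
  change (EuclideanSpace.basisFun ι ℂ).toBasis.toMatrix b a (f i) = W i a
  rw [Module.Basis.toMatrix_apply, hb _ ⟨i, rfl⟩, hv]
  simp

/-- The measurement of a register in the computational basis, followed by a Boolean function. -/
noncomputable def BinaryMeasurement.ofFun {k : ℕ} (g : Bits k → Bool) : BinaryMeasurement k where
  effect o := diagonal fun w => if g w = o then 1 else 0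
  posSemidef o := Matrix.PosSemidef.diagonal fun w => by
    change (0 : ℂ) ≤ if g w = o then 1 else 0
    split_ifs <;> simp
  sum_eq_one := by
    rw [diagonal_add, ← diagonal_one]
    congr 1
    funext w
    cases g w <;> simp

theorem BinaryMeasurement.prob_ofFun {k m : ℕ} (g : Bits k → Bool) (ψ : JointState k m) (o : Bool) :
    (BinaryMeasurement.ofFun g).prob ψ o = ∑ t, ∑ s, if g s = o then ‖ψ s t‖ ^ 2 else 0 := by
  simp only [BinaryMeasurement.prob, BinaryMeasurement.ofFun, dotProduct, mulVec_diagonal,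
    Complex.re_sum, Pi.star_apply]
  refine Finset.sum_congr rfl fun t _ => Finset.sum_congr rfl fun s _ => ?_
  split_ifs
  · rw [one_mul, Complex.star_def, Complex.conj_mul']
    norm_cast
  · simp

/-- A two-round protocol whose messages start from empty registers, given by the first message
`φ x`, and by an isometry `W y` of the receiver's register that keeps the basis state `s` and sends
`g y s`. -/
theorem exists_protocol_two {X : Type*} {L l : ℕ} (φ : X → Bits L → ℂ)
    (hφ : ∀ x, star (φ x) ⬝ᵥ φ x = 1) (D : X → Matrix (Bits L) (Bits L) ℂ)
    (hD : ∀ y, D y ∈ unitaryGroup (Bits L) ℂ) (g : X → Bits L → Bits l)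
    (out : X → Bits l → Bool) :
    ∃ P : QProtocol X 2 0 0, P.cost = L + l ∧ ∀ x y o, P.prob x y o
      = ∑ s, if out x (g y s) = o then ‖(D y *ᵥ φ x) s‖ ^ 2 else 0 := by
  -- A receiver with an empty register ends up with `0 + j` qubits, which have to be identified with
  -- `j` qubits.
  obtain ⟨e, he⟩ : ∃ e : ∀ j : ℕ, Bits (0 + j) ≃ Bits j,
      ∀ j (w : Bits (0 + j)), (fun i => w (Fin.natAdd 0 i)) = e j w := by
    refine ⟨fun j => Equiv.arrowCongr (finCongr (Nat.zero_add j)) (Equiv.refl Bool), fun j w => ?_⟩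
    funext i
    simp only [Equiv.arrowCongr_apply, Function.comp, Equiv.refl_apply]
    congr 1
    ext
    simp
  have h1 : ∀ x, ∃ U : unitaryGroup (Bits 0 × Bits L) ℂ, ∀ a,
      U.1 a (fun _ => false, fun _ => false) = φ x a.2 := by
    intro x
    obtain ⟨U, hU⟩ := exists_unitary_with_columns (κ := Unit) (ι := Bits 0 × Bits L)
      ⟨fun _ => (fun _ => false, fun _ => false), fun _ _ _ => rfl⟩ (fun _ a => φ x a.2)
      (fun _ _ => by
        rw [if_pos rfl, ← hφ x]
        simp [dotProduct, Fintype.sum_prod_type])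
    exact ⟨U, fun a => hU a ()⟩
  -- Only the columns with fresh qubits equal to zero are prescribed. Keeping `s` in the register
  -- acts as a measurement, so the final probabilities add up over `s` without interference.
  have h2 : ∀ y, ∃ V : unitaryGroup (Bits (0 + L) × Bits l) ℂ, ∀ a s',
      V.1 a (s', fun _ => false)
        = if a.2 = g y (e L a.1) then D y (e L a.1) (e L s') else 0 := by
    intro y
    refine exists_unitary_with_columns (κ := Bits (0 + L)) (ι := Bits (0 + L) × Bits l)
      ⟨fun s' => (s', fun _ => false), fun _ _ h => (Prod.ext_iff.1 h).1⟩
      (fun s' a => if a.2 = g y (e L a.1) then D y (e L a.1) (e L s') else 0) (fun i j => ?_)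
    have h := congrFun (congrFun (mem_unitaryGroup_iff'.1 (hD y)) (e L i)) (e L j)
    rw [Matrix.mul_apply, Matrix.one_apply] at h
    simp only [EmbeddingLike.apply_eq_iff_eq] at h
    rw [← h, dotProduct, Fintype.sum_prod_type, ← Equiv.sum_comp (e L)]
    refine Finset.sum_congr rfl fun s _ => ?_
    simp [Matrix.star_apply, apply_ite]
  choose U hU using h1
  choose V hV using h2
  refine ⟨.send L U (.send l V (.output fun x => .ofFun fun w => out x (e l w))), rfl,
    fun x y o => ?_⟩
  have hψ : ∀ w s, sendQubits (U x).1 (JointState.zero 0 0) w s = φ x (e L w) := by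
    intro w s
    rw [sendQubits_zero, if_pos (Subsingleton.elim _ _), he,
      Subsingleton.elim s fun _ => false, hU]
  have hfin : ∀ ψ : JointState (0 + L) 0, (∀ w s, ψ w s = φ x (e L w)) → ∀ w s,
      sendQubits (V y).1 ψ w s = if e l w = g y (e L s) then (D y *ᵥ φ x) (e L s) else 0 := by
    intro ψ hψ w s
    unfold sendQubits
    simp only [he, hV, hψ]
    split_ifs
    · rw [mulVec, dotProduct, ← Equiv.sum_comp (e L)]
    · simp
  change (BinaryMeasurement.ofFun _).prob
    (sendQubits (V y).1 (sendQubits (U x).1 (JointState.zero 0 0))) o = _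
  rw [BinaryMeasurement.prob_ofFun, ← Equiv.sum_comp (e L)]
  refine Finset.sum_congr rfl fun s _ => ?_
  rw [Finset.sum_eq_single ((e l).symm (g y (e L s)))]
  · simp [hfin _ hψ]
  · intro w _ hw
    have : e l w ≠ g y (e L s) := fun h => hw (by rw [← h, Equiv.symm_apply_apply])
    simp [hfin _ hψ, this]
  · simp

/-- The Householder reflection `2uuᵀ - 1`, preceded by the sign change `σ`. -/
theorem reflection_mul_diagonal_mem_unitaryGroup {κ : Type*} [Fintype κ] [DecidableEq κ]
    (u σ : κ → ℝ) (hu : ∑ i, u i ^ 2 = 1) (hσ : ∀ i, σ i ^ 2 = 1) :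
    (Matrix.of fun i j => (((2 * u i * u j - if i = j then 1 else 0) * σ j : ℝ) : ℂ))
      ∈ unitaryGroup κ ℂ := by
  rw [mem_unitaryGroup_iff']
  ext i j
  rw [Matrix.mul_apply]
  simp only [Matrix.star_apply, Matrix.of_apply, Complex.star_def, Complex.conj_ofReal,
    Matrix.one_apply]
  have h : ∑ s, (2 * u s * u i - if s = i then 1 else 0) * σ i
      * ((2 * u s * u j - if s = j then 1 else 0) * σ j) = if i = j then 1 else 0 := by
    have : ∀ s, (2 * u s * u i - if s = i then 1 else 0) * σ i
        * ((2 * u s * u j - if s = j then 1 else 0) * σ j)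
        = 4 * u i * u j * σ i * σ j * u s ^ 2 - (if s = i then 2 * u s * u j * σ i * σ j else 0)
          - (if s = j then 2 * u s * u i * σ i * σ j else 0)
          + (if s = i then (if s = j then σ i * σ j else 0) else 0) := by
      intro s
      split_ifs <;> ring
    simp only [this, Finset.sum_add_distrib, Finset.sum_sub_distrib, ← Finset.mul_sum, hu,
      Finset.sum_ite_eq', Finset.mem_univ, if_true]
    by_cases hij : i = j
    · subst hij
      simp only [if_true]
      linear_combination hσ i
    · simp only [hij, if_false]
      ring
  simp only [← Complex.ofReal_mul, ← Complex.ofReal_sum]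
  rw [h]
  split_ifs <;> simp

theorem sum_ite_eq_one_neg_one {n : ℕ} (x y : Bits n) :
    ∑ i, (if x i = y i then (1 : ℝ) else -1) = n - 2 * hammingDist x y := by
  have h : ∀ i, (if x i = y i then (1 : ℝ) else -1) = 1 - 2 * if x i ≠ y i then 1 else 0 := by
    intro i
    split_ifs <;> first | contradiction | norm_num
  simp only [h, Finset.sum_sub_distrib, ← Finset.mul_sum, Finset.sum_boole, hammingDist]
  simp

/-- With mean sign `μ = 1 - 2 * dist / n`, the reflection turns a sign `ε` into `2 * μ - ε`. For `x
= y` this is `1` everywhere. At distance `n/4` one has `μ = 1/2`, giving `0` where the strings agree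
and `2` where they differ. -/
theorem quantumComplexity_two_le {n : ℕ} (hn : 0 < n) (h4 : 4 ∣ n) :
    quantumComplexity 2 (hammingGraph n (n / 4)) ≤ ((2 * Nat.clog 2 n + 1 : ℕ) : ℕ∞) := by
  classical
  set L := Nat.clog 2 n with hL
  have hn' : (n : ℝ) ≠ 0 := by exact_mod_cast hn.ne'
  obtain ⟨f⟩ : Nonempty (Fin n ↪ Bits L) := Function.Embedding.nonempty_of_card_le (by
    simpa using Nat.le_pow_clog one_lt_two n)
  -- Labels outside the range of `f` get the default bit `false`. This is harmless, since `u`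
  -- vanishes on them.
  let t : Bits n → Bits L → Bool := fun x b => decide (∃ i, f i = b ∧ x i = true)
  have ht : ∀ x i, t x (f i) = x i := by
    intro x i
    simp only [t, f.injective.eq_iff, exists_eq_left, Bool.decide_eq_true]
  let u : Bits L → ℝ := fun b => if b ∈ Set.range f then 1 / √n else 0
  have hu : ∀ i, u (f i) = 1 / √n := fun i => if_pos ⟨i, rfl⟩
  have hu2 : ∀ i, u (f i) ^ 2 = 1 / n := fun i => by
    rw [hu, div_pow, one_pow, Real.sq_sqrt (Nat.cast_nonneg n)]
  have hu0 : ∀ b, b ∉ Set.range f → u b = 0 := fun b hb => if_neg hb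
  have hsum : ∀ F : Bits L → ℝ, (∀ b, u b = 0 → F b = 0) → ∑ b, F b = ∑ i, F (f i) := fun F hF =>
    (Fintype.sum_of_injective f f.injective _ _ (fun b hb => hF b (hu0 b hb)) fun _ => rfl).symm
  let σ : Bits n → Bits L → ℝ := fun x b => if t x b then -1 else 1
  have hσ : ∀ x b, σ x b ^ 2 = 1 := by
    intro x b
    simp only [σ]
    split_ifs <;> norm_num
  have hσσ : ∀ x y b, σ x b * σ y b = if t x b = t y b then 1 else -1 := by
    intro x y b
    simp only [σ]
    cases t x b <;> cases t y b <;> norm_num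
  have hone : ∑ b, u b ^ 2 = 1 := by
    rw [hsum _ fun b hb => by rw [hb]; norm_num]
    simp [hu2, hn']
  obtain ⟨P, hcost, hP⟩ := exists_protocol_two (X := Bits n) (L := L) (l := L + 1)
    (fun x b => ((σ x b * u b : ℝ) : ℂ))
    (fun x => by
      simp only [dotProduct, Pi.star_apply, Complex.star_def, Complex.conj_ofReal,
        ← Complex.ofReal_mul, ← Complex.ofReal_sum]
      rw [← Complex.ofReal_one, ← hone]
      refine congrArg _ (Finset.sum_congr rfl fun b _ => ?_)
      linear_combination u b ^ 2 * hσ x b)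
    _ (fun y => reflection_mul_diagonal_mem_unitaryGroup u (σ y) hone (hσ y))
    -- The reply is the label followed by the bit of `y` there, hence `L + 1` qubits. The other
    -- party compares that bit with its own.
    (fun y b => Fin.snoc (α := fun _ => Bool) b (t y b))
    (fun x w => t x (Fin.init (α := fun _ => Bool) w) == w (Fin.last L))
  refine (iInf_le_of_le 0 <| iInf_le_of_le 0 <| iInf_le_of_le P <| iInf_le_of_le (i := ?_) ?_)
  swap
  · rw [hcost, show L + (L + 1) = 2 * L + 1 by omega]
  have hprob : ∀ x y o, P.prob x y o = ∑ i, if (x i == y i) = o then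
      (1 / n * (2 * (1 - 2 * hammingDist x y / n) - if x i = y i then 1 else -1) ^ 2 : ℝ) else 0 := by
    intro x y o
    have hμ : ∑ b, u b ^ 2 * (σ x b * σ y b) = 1 - 2 * hammingDist x y / n := by
      rw [hsum _ fun b hb => by rw [hb]; ring]
      simp only [hu2, hσσ, ht, ← Finset.mul_sum, sum_ite_eq_one_neg_one]
      field_simp
    have hamp : ∀ b, (((Matrix.of fun i j =>
        (((2 * u i * u j - if i = j then 1 else 0) * σ y j : ℝ) : ℂ)) : Matrix (Bits L) (Bits L) ℂ)
          *ᵥ fun b => ((σ x b * u b : ℝ) : ℂ)) b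
        = ((u b * (2 * (1 - 2 * hammingDist x y / n) - σ x b * σ y b) : ℝ) : ℂ) := by
      intro b
      simp only [mulVec, dotProduct, Matrix.of_apply, ← Complex.ofReal_mul, ← Complex.ofReal_sum]
      refine congrArg _ ?_
      have : ∀ j, (2 * u b * u j - if b = j then 1 else 0) * σ y j * (σ x j * u j)
          = 2 * u b * (u j ^ 2 * (σ x j * σ y j)) - if b = j then σ y j * (σ x j * u j) else 0 := by
        intro j
        split_ifs <;> ring
      simp only [this, Finset.sum_sub_distrib, ← Finset.mul_sum, hμ, Finset.sum_ite_eq,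
        Finset.mem_univ, if_true]
      ring
    rw [hP]
    simp only [hamp, Complex.norm_real, Real.norm_eq_abs, sq_abs, Fin.init_snoc, Fin.snoc_last]
    rw [hsum _ fun b hb => by simp [hb]]
    refine Finset.sum_congr rfl fun i _ => ?_
    rw [ht, ht, mul_pow, hu2, hσσ, ht, ht]
  refine ⟨fun x => ?_, fun x y hxy => ?_⟩
  · rw [hprob]
    simp only [hammingDist_self, beq_self_eq_true, if_true]
    norm_num [hn']
  · rw [hprob]
    obtain ⟨m, rfl⟩ := h4
    obtain ⟨-, hd⟩ := hxy
    rw [Nat.mul_div_cancel_left m (by norm_num)] at hd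
    have hm : (m : ℝ) ≠ 0 := by
      rintro h
      simp [h] at hn'
    -- Each of the `m` differing positions contributes `2^2 / (4 * m) = 1 / m` to the probability.
    have hterm : ∀ i, (if (x i == y i) = false then 1 / ((4 * m : ℕ) : ℝ) * (2 * (1 - 2 * hammingDist x y
        / ((4 * m : ℕ) : ℝ)) - if x i = y i then 1 else -1) ^ 2 else (0 : ℝ))
        = 1 / m * if x i ≠ y i then 1 else 0 := by
      intro i
      by_cases h : x i = y i
      · simp [h]
      · rw [if_pos (by simp [h]), if_neg h, if_pos h, hd]
        push_cast
        field_simp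
        norm_num
    rw [Finset.sum_congr rfl fun i _ => hterm i, ← Finset.mul_sum, Finset.sum_boole]
    change 1 / (m : ℝ) * (hammingDist x y : ℕ) = 1
    rw [hd]
    field_simp

end TwoRound

/-! ### The absolute constants. -/

theorem two_mul_clog_add_one_le {n : ℕ} (hn : 8 ≤ n) :
    ((2 * Nat.clog 2 n + 1 : ℕ) : ℝ) ≤ 3 * Real.logb 2 n := by
  -- Rounding up costs at most `1`, so the left side is at most `2 * logb 2 n + 3`, and the `3` is
  -- absorbed because `n ≥ 8`.
  have h3 : 3 ≤ Real.logb 2 n := by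
    rw [Real.le_logb_iff_rpow_le one_lt_two (by positivity)]
    norm_num
    exact_mod_cast hn
  have hc : (Nat.clog 2 n : ℝ) ≤ Real.logb 2 n + 1 := by
    rw [← Real.natCeil_logb_natCast, Nat.cast_ofNat]
    exact (Nat.ceil_lt_add_one (by linarith)).le
  push_cast
  linarith

theorem mainTheorem1 :
    ∃ c C : ℝ, 0 < c ∧ 0 < C ∧ ∀ n : ℕ, 0 < n → 8 ∣ n →
      ENNReal.ofReal (c * n) ≤ (quantumComplexity 1 (hammingGraph n (n / 4)) : ℝ≥0∞) ∧
      quantumComplexity 2 (hammingGraph n (n / 4)) ≤ ((2 * Nat.clog 2 n + 1 : ℕ) : ℕ∞) ∧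
      ((2 * Nat.clog 2 n + 1 : ℕ) : ℝ) ≤ C * Real.logb 2 n :=
  ⟨1 / 1300, 3, by norm_num, by norm_num, fun _ hn h8 =>
    ⟨le_quantumComplexity_one hn h8,
      quantumComplexity_two_le hn (dvd_trans (by norm_num) h8),
      two_mul_clog_add_one_le (Nat.le_of_dvd hn h8)⟩⟩
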